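/- **Conventions.** A *representation* of a set $X$ is a surjective partial map from infinite strings (names) onto $X$. A $\rho$-name of $x\in\mathbb R$ is a sequence of rationals $q_n$ with $|x-q_n|\le 2^{-n}$; a $\rho_<$-name of $x$ is a sequence of rationals with supremum $x$; a $[\rho\to\rho]$-name of a continuous $f:[0,1]\to\mathbb R$ encodes a continuous operator on names that maps every $\rho$-name of every $x\in[0,1]$ to a $\rho$-name of $f(x)$; a $\psi_>$-name of a nonempty closed set $A\subseteq\mathbb R$ is a $[\rho\to\rho_<]$-name of its distance function $d_A$, i.e. it provides approximations of $d_A$ from below. Let $f:\subseteq A\rightrightarrows B$ be a partial multivalued mapping, $\operatorname{dom}(f)=\{a: f(a)\neq\emptyset\}$. * Between topological spaces, the restriction $f|_D$ to $D\subseteq\operatorname{dom}(f)$ is *continuous* if for every $x\in D$ there is some $y\in f(x)$ such that every open $V\ni y$ admits a neighbourhood $U$ of $x$ with $f(z)\cap V\ne\emptyset$ for all $z\in U\cap D$. The *cardinal of discontinuity* $\mathfrak C_{\rm t}(f)$ is the least cardinality of a covering $\Delta$ of $\operatorname{dom}(f)=\bigcup\Delta$ such that $f|_D$ is continuous for all $D\in\Delta$.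 * Between represented spaces $(A,\alpha)$, $(B,\beta)$, the *complexity of nonuniform computability* $\mathfrak C_{\rm c}(f,\alpha,\beta)$ is the least cardinality of an at most countable partition $\Delta$ of $\operatorname{dom}(f)$ for which there are a notation $\delta$ of $\Delta$ and a computable operator that maps every $\alpha$-name of $a$ together with every $\delta$-name of $D$, where $a\in D\in\Delta$, to a $\beta$-name of some element of $f(a)$. * $f$ is *$d$-wise $(\alpha,\beta)$-continuous* if $\operatorname{dom}(f)$ has a partition $\Delta$ of cardinality $d$ such that for each $D\in\Delta$ there is a continuous function $F$ on names that maps every $\alpha$-name of every $a\in D$ to a $\beta$-name of some element of $f(a)$. **Theorem.** (a) Let $C[0,1]$ carry the supremum norm. The multivalued mapping $\operatorname{Intermed}:\subseteq C[0,1]\rightrightarrows[0,1]$, $f\mapsto f^{-1}[0]$, with domain $\{f:[0,1]\to[-1,1]\text{ continuous},\ f(0)=-1,\ f(1)=1\}$ satisfies $$\mathfrak C_{\rm c}(\operatorname{Intermed},[\rho\to\rho],\rho)=\mathfrak C_{\rm t}(\operatorname{Intermed})=\omega ,$$ where $\omega$ is the countably infinite cardinal. (b) The multivalued mapping $\operatorname{Select}:[a,b]\mapsto[a,b]$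 with domain $\{[a,b]:0\le a<b\le 1\}$, of selecting some point of a given nondegenerate closed interval, is not $d$-wise $(\psi_>,\rho)$-continuous for any $d\in\mathbb N$. -/

import Mathlib

/-! Represented spaces over Baire space, Kleene application, discrete advice. -/

open Topology Cardinal

namespace Advice

/-- The standard numbering of the rationals: the triple coded by `n` as `⟨⟨a, b⟩, c⟩`
denotes `(a - b) / (c + 1)`. -/
def ratOf (n : ℕ) : ℚ :=
  ((n.unpair.1.unpair.1 : ℚ) - (n.unpair.1.unpair.2 : ℚ)) / ((n.unpair.2 : ℚ) + 1)

theorem ratOf_surjective : Function.Surjective ratOf := by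
  intro q
  refine ⟨Nat.pair (Nat.pair q.num.toNat (-q.num).toNat) (q.den - 1), ?_⟩
  have h1 : ((q.num.toNat : ℚ) - ((-q.num).toNat : ℚ)) = (q.num : ℚ) := by
    have : ((q.num.toNat : ℤ) - ((-q.num).toNat : ℤ)) = q.num := by omega
    exact_mod_cast this
  have h2 : (((q.den - 1 : ℕ) : ℚ) + 1) = (q.den : ℚ) := by
    have : q.den - 1 + 1 = q.den := Nat.sub_add_cancel q.pos
    exact_mod_cast this
  simp only [ratOf, Nat.unpair_pair]
  rw [h1, h2, Rat.num_div_den]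

/-- A representation of `X`: a surjective partial map from infinite sequences onto `X`, given by
its graph (`Name p x` says that `p` is a name of `x`).  Sequences of natural numbers are used;
they correspond to infinite binary strings by the usual computable encoding. -/
structure Representation (X : Type) where
  Name : (ℕ → ℕ) → X → Prop
  unique : ∀ p x y, Name p x → Name p y → x = y
  surj : ∀ x, ∃ p, Name p x

/-- Code of the word `n, q 0, …, q (k - 1)`. -/
def prefixCode (n : ℕ) (q : ℕ → ℕ) (k : ℕ) : ℕ :=
  Encodable.encode (n :: (List.range k).map q)

/-- Kleene application: the program `p`, run on the infinite input `q`, writes the infinite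
output `r`.  The `n`-th output is determined by the first finite prefix of `q` on which `p`
answers (a positive value `v + 1` means output `v`, the value `0` means: read more input).
The functions `q ↦ r` obtained from arbitrary `p` are, up to restriction of the domain, the
continuous partial functions on sequences; those obtained from computable `p` are the functions
computed by Type-2 Turing machines. -/
def KApp (p q r : ℕ → ℕ) : Prop :=
  ∀ n, ∃ k, p (prefixCode n q k) = r n + 1 ∧ ∀ j < k, p (prefixCode n q j) = 0

/-- The input sequence `i, q 0, q 1, …`, which stands for the pair `(q, i)`. -/
def consSeq (i : ℕ) (q : ℕ → ℕ) : ℕ → ℕ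
  | 0 => i
  | n + 1 => q n

/-- `p` names the function `f` in the function space representation `[α → β]`:
applied to any `α`-name of any `x` it yields a `β`-name of `f x`. -/
def FunName {X Y : Type} (α : Representation X) (β : Representation Y)
    (p : ℕ → ℕ) (f : X → Y) : Prop :=
  ∀ q x, α.Name q x → ∃ r, KApp p q r ∧ β.Name r (f x)

theorem KApp.unique {p q r s : ℕ → ℕ} (h : KApp p q r) (h' : KApp p q s) : r = s := by
  funext n
  obtain ⟨k, hk, hk'⟩ := h n
  obtain ⟨l, hl, hl'⟩ := h' n
  rcases lt_trichotomy k l with hkl | hkl | hkl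
  · have := hl' k hkl
    omega
  · subst hkl
    omega
  · have := hk' l hkl
    omega

theorem FunName.unique {X Y : Type} {α : Representation X} {β : Representation Y}
    {p : ℕ → ℕ} {f g : X → Y} (hf : FunName α β p f) (hg : FunName α β p g) : f = g := by
  funext x
  obtain ⟨q, hq⟩ := α.surj x
  obtain ⟨r, hr, hr'⟩ := hf q x hq
  obtain ⟨s, hs, hs'⟩ := hg q x hq
  obtain rfl := hr.unique hs
  exact β.unique _ _ _ hr' hs'

/-- The property of `q` to be a sequence of rational approximations of `x`, with the `n`-th
error at most `2 ^ (-n)`. -/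
def IsCauchyName (q : ℕ → ℕ) (x : ℝ) : Prop :=
  ∀ n, |x - (ratOf (q n) : ℝ)| ≤ (1 / 2 : ℝ) ^ n

/-- The representation `ρ` of the real numbers. -/
def realRep : Representation ℝ where
  Name := IsCauchyName
  unique := by
    intro p x y hx hy
    have key : ∀ n, |x - y| ≤ 2 * (1 / 2 : ℝ) ^ n := fun n => by
      have h1 := abs_le.1 (hx n)
      have h2 := abs_le.1 (hy n)
      exact abs_le.2 ⟨by linarith [h1.1, h2.2], by linarith [h1.2, h2.1]⟩
    have lim : Filter.Tendsto (fun n : ℕ => 2 * (1 / 2 : ℝ) ^ n) Filter.atTop (𝓝 (2 * 0)) :=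
      (tendsto_pow_atTop_nhds_zero_of_lt_one (by norm_num) (by norm_num)).const_mul 2
    have h0 := ge_of_tendsto' lim key
    have : |x - y| = 0 := le_antisymm (by simpa using h0) (abs_nonneg _)
    exact sub_eq_zero.1 (abs_eq_zero.1 this)
  surj := by
    intro x
    have : ∀ n : ℕ, ∃ c : ℕ, |x - (ratOf c : ℝ)| ≤ (1 / 2 : ℝ) ^ n := fun n => by
      obtain ⟨a, ha1, ha2⟩ := exists_rat_btwn (show x - (1 / 2 : ℝ) ^ n < x by
        have : (0 : ℝ) < (1 / 2 : ℝ) ^ n := by positivity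
        linarith)
      obtain ⟨c, rfl⟩ := ratOf_surjective a
      exact ⟨c, abs_le.2 ⟨by linarith, by linarith⟩⟩
    choose q hq using this
    exact ⟨q, hq⟩

/-- A sequence of codes of rationals whose supremum is `x`, obtained from lower approximations. -/
theorem isLUB_of_approx {x : ℝ} {r : ℕ → ℕ}
    (h : ∀ n, (ratOf (r n) : ℝ) ≤ x ∧ x ≤ (ratOf (r n) : ℝ) + (1 / 2 : ℝ) ^ n) :
    IsLUB (Set.range fun n => (ratOf (r n) : ℝ)) x := by
  refine ⟨?_, fun b hb => ?_⟩
  · rintro _ ⟨n, rfl⟩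
    exact (h n).1
  · have lim : Filter.Tendsto (fun n : ℕ => b + (1 / 2 : ℝ) ^ n) Filter.atTop (𝓝 (b + 0)) :=
      (tendsto_pow_atTop_nhds_zero_of_lt_one (by norm_num) (by norm_num)).const_add b
    have := ge_of_tendsto' lim (b := x) fun n => by
      have := hb ⟨n, rfl⟩
      have h2 := (h n).2
      simp only at this
      linarith
    simpa using this

theorem exists_lower (x : ℝ) (n : ℕ) :
    ∃ c : ℕ, (ratOf c : ℝ) < x ∧ x < (ratOf c : ℝ) + (1 / 2 : ℝ) ^ n := by
  obtain ⟨a, ha1, ha2⟩ := exists_rat_btwn (show x - (1 / 2 : ℝ) ^ n < x by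
    have : (0 : ℝ) < (1 / 2 : ℝ) ^ n := by positivity
    linarith)
  obtain ⟨c, rfl⟩ := ratOf_surjective a
  exact ⟨c, ha2, by linarith⟩

/-- The representation `ρ_<` of the real numbers: a name of `x` is a sequence of rationals with
supremum `x`. -/
def lowerRealRep : Representation ℝ where
  Name p x := IsLUB (Set.range fun n => (ratOf (p n) : ℝ)) x
  unique := fun _ _ _ hx hy => hx.unique hy
  surj := by
    intro x
    choose r hr using exists_lower x
    exact ⟨r, isLUB_of_approx fun n => ⟨(hr n).1.le, (hr n).2.le⟩⟩

/-- Every continuous real function on a space of reals has a name. -/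
theorem exists_funName {X : Type} [TopologicalSpace X] (i : X → ℝ) (hi : IsInducing i)
    (g : X → ℝ) (hg : Continuous g) :
    ∃ p, ∀ q x, IsCauchyName q (i x) → ∃ r, KApp p q r ∧
      ∀ n, (ratOf (r n) : ℝ) ≤ g x ∧ g x ≤ (ratOf (r n) : ℝ) + (1 / 2 : ℝ) ^ n := by
  classical
  let good : ℕ → List ℕ → ℕ → Prop := fun n u c =>
    ∀ x, (∀ k (hk : k < u.length), |i x - (ratOf u[k] : ℝ)| ≤ (1 / 2 : ℝ) ^ k) →
      (ratOf c : ℝ) ≤ g x ∧ g x ≤ (ratOf c : ℝ) + (1 / 2 : ℝ) ^ n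
  let val : List ℕ → ℕ := fun l =>
    match l with
    | [] => 0
    | n :: u => if h : ∃ c, good n u c then h.choose + 1 else 0
  let p : ℕ → ℕ := fun m => ((Encodable.decode (α := List ℕ) m).map val).getD 0
  have hp : ∀ n q k, p (prefixCode n q k) =
      if h : ∃ c, good n ((List.range k).map q) c then h.choose + 1 else 0 := by
    intro n q k
    simp [p, prefixCode, val]
  refine ⟨p, fun q x hq => ?_⟩
  have ex : ∀ n, ∃ k, ∃ c, good n ((List.range k).map q) c := by
    intro n
    obtain ⟨c, hc1, hc2⟩ := exists_lower (g x) n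
    have hU : {y | (ratOf c : ℝ) < g y ∧ g y < (ratOf c : ℝ) + (1 / 2 : ℝ) ^ n} ∈ 𝓝 x :=
      hg.continuousAt (Ioo_mem_nhds hc1 hc2)
    rw [hi.nhds_eq_comap] at hU
    obtain ⟨W, hW, hWU⟩ := hU
    obtain ⟨ε, hε, hball⟩ := Metric.mem_nhds_iff.1 hW
    obtain ⟨k, hk⟩ := exists_pow_lt_of_lt_one (show (0 : ℝ) < ε / 2 by linarith)
      (show (1 / 2 : ℝ) < 1 by norm_num)
    refine ⟨k + 1, c, fun y hy => ?_⟩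
    have h1 := abs_le.1 (hy k (by simp))
    have h2 := abs_le.1 (hq k)
    simp only [List.getElem_map, List.getElem_range] at h1
    have : i y ∈ Metric.ball (i x) ε := by
      rw [Metric.mem_ball, Real.dist_eq]
      exact abs_lt.2 ⟨by linarith [h1.1, h2.2], by linarith [h1.2, h2.1]⟩
    have := hWU (show y ∈ i ⁻¹' W from hball this)
    exact ⟨this.1.le, this.2.le⟩
  refine ⟨fun n => (Nat.find_spec (ex n)).choose, fun n => ⟨Nat.find (ex n), ?_, ?_⟩, fun n => ?_⟩
  · rw [hp, dif_pos (Nat.find_spec (ex n))]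
  · intro j hj
    rw [hp, dif_neg (Nat.find_min (ex n) hj)]
  · refine (Nat.find_spec (ex n)).choose_spec x fun k hk => ?_
    simpa using hq k

/-- The restriction of a representation to the elements of a subset. -/
def Representation.restrict {X : Type} (α : Representation X) (S : Set X) :
    Representation S where
  Name p x := α.Name p x
  unique := fun p x y hx hy => Subtype.ext (α.unique p x y hx hy)
  surj := fun x => α.surj x

/-- `ρ` on the unit interval. -/
def unitRep : Representation unitInterval := realRep.restrict unitInterval

/-- The representation `[ρ → ρ]` of the space of continuous real functions on `[0, 1]`. -/
def contRep : Representation C(unitInterval, ℝ) where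
  Name p f := FunName unitRep realRep p f
  unique := fun _ _ _ hf hg => DFunLike.coe_injective (hf.unique hg)
  surj := by
    intro f
    obtain ⟨p, hp⟩ := exists_funName (Subtype.val : unitInterval → ℝ) IsInducing.subtypeVal f
      f.continuous
    refine ⟨p, fun q x hq => ?_⟩
    obtain ⟨r, hr, h⟩ := hp q x hq
    exact ⟨r, hr, fun n => abs_le.2 ⟨by
      have : (0 : ℝ) ≤ (1 / 2 : ℝ) ^ n := by positivity
      linarith [(h n).1], by linarith [(h n).2]⟩⟩

/-- The nonempty closed subsets of the real line. -/
def ClosedSets : Type := {A : Set ℝ // IsClosed A ∧ A.Nonempty}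

/-- The representation `ψ_>` of nonempty closed sets: a name of `A` is a `[ρ → ρ_<]`-name of the
distance function of `A`, that is, it provides approximations of the distance from below. -/
def psiGreater : Representation ClosedSets where
  Name p A := FunName realRep lowerRealRep p fun x => Metric.infDist x A.1
  unique := by
    intro p A B hA hB
    have h := hA.unique hB
    refine Subtype.ext (Set.ext fun x => ?_)
    rw [A.2.1.mem_iff_infDist_zero A.2.2, B.2.1.mem_iff_infDist_zero B.2.2]
    exact (congrFun h x) ▸ Iff.rfl
  surj := by
    intro A
    obtain ⟨p, hp⟩ := exists_funName (id : ℝ → ℝ) IsInducing.id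
      (fun x => Metric.infDist x A.1) (Metric.continuous_infDist_pt A.1)
    refine ⟨p, fun q x hq => ?_⟩
    obtain ⟨r, hr, h⟩ := hp q x hq
    exact ⟨r, hr, isLUB_of_approx h⟩

section Multivalued

variable {A B : Type}

/-- The domain of a partial multivalued mapping `f`. -/
def mdom (f : A → Set B) : Set A := {a | (f a).Nonempty}

/-- Continuity of the restriction of the multivalued mapping `f` to `D`: at every `x ∈ D` there is
a value `y ∈ f x` each of whose neighbourhoods is met by `f z` for all `z ∈ D` close to `x`. -/
def MContinuousOn [TopologicalSpace A] [TopologicalSpace B] (f : A → Set B) (D : Set A) : Prop :=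
  ∀ x ∈ D, ∃ y ∈ f x, ∀ V : Set B, IsOpen V → y ∈ V →
    ∃ U ∈ 𝓝 x, ∀ z ∈ U ∩ D, (f z ∩ V).Nonempty

/-- `k`-continuity: the domain is covered by `k` sets on each of which `f` is continuous. -/
def KContinuous [TopologicalSpace A] [TopologicalSpace B] (f : A → Set B) (k : Cardinal) : Prop :=
  ∃ Δ : Set (Set A), ⋃₀ Δ = mdom f ∧ #Δ = k ∧ ∀ D ∈ Δ, MContinuousOn f D

/-- The cardinal of discontinuity `ℭ_t(f)`. -/
noncomputable def discontinuityCardinal [TopologicalSpace A] [TopologicalSpace B]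
    (f : A → Set B) : Cardinal :=
  sInf {k | KContinuous f k}

/-- `Δ` is a partition of the set `S`. -/
def IsPartitionOf (Δ : Set (Set A)) (S : Set A) : Prop :=
  ⋃₀ Δ = S ∧ Δ.PairwiseDisjoint id ∧ ∅ ∉ Δ

/-- Computability with `k`-wise advice: there are an at most countable partition `Δ` of the domain,
of cardinality `k`, a notation `δ` of `Δ` (a partial map from `ℕ` onto `Δ`) and a computable
program `t` which turns every `α`-name of every `a ∈ D ∈ Δ`, together with every `δ`-code of `D`,
into a `β`-name of some value of `f` at `a`. -/
def KComputable (α : Representation A) (β : Representation B) (f : A → Set B)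
    (k : Cardinal) : Prop :=
  ∃ Δ : Set (Set A), IsPartitionOf Δ (mdom f) ∧ Δ.Countable ∧ #Δ = k ∧
    ∃ δ : ℕ →. Set A, δ.ran = Δ ∧
      ∃ t : ℕ → ℕ, Computable t ∧
        ∀ i D a q, D ∈ δ i → a ∈ D → α.Name q a →
          ∃ r, KApp t (consSeq i q) r ∧ ∃ b ∈ f a, β.Name r b

/-- The complexity of nonuniform computability `ℭ_c(f, α, β)`. -/
noncomputable def computabilityCardinal (α : Representation A) (β : Representation B)
    (f : A → Set B) : Cardinal :=
  sInf {k | KComputable α β f k}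

/-- `(α, β)`-continuity of the restriction of `f` to `D`: there is a continuous realizer. -/
def HasContinuousRealizerOn (α : Representation A) (β : Representation B) (f : A → Set B)
    (D : Set A) : Prop :=
  ∃ F : (ℕ → ℕ) → (ℕ → ℕ), ContinuousOn F {q | ∃ a ∈ D, α.Name q a} ∧
    ∀ a ∈ D, ∀ q, α.Name q a → ∃ b ∈ f a, β.Name (F q) b

/-- `k`-wise `(α, β)`-continuity. -/
def KwiseContinuous (α : Representation A) (β : Representation B) (f : A → Set B)
    (k : Cardinal) : Prop :=
  ∃ Δ : Set (Set A), IsPartitionOf Δ (mdom f) ∧ #Δ = k ∧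
    ∀ D ∈ Δ, HasContinuousRealizerOn α β f D

end Multivalued

/-- The zero-finding problem, on continuous `f : [0, 1] → [-1, 1]` with `f 0 = -1`, `f 1 = 1`. -/
def Intermed (f : C(unitInterval, ℝ)) : Set unitInterval :=
  {x | ((∀ t, f t ∈ Set.Icc (-1 : ℝ) 1) ∧ f 0 = -1 ∧ f 1 = 1) ∧ f x = 0}

/-- The problem of selecting a point, on the nondegenerate closed intervals `[a, b] ⊆ [0, 1]`. -/
def Select (S : ClosedSets) : Set ℝ :=
  {y | (∃ a b : ℝ, 0 ≤ a ∧ a < b ∧ b ≤ 1 ∧ S.1 = Set.Icc a b) ∧ y ∈ S.1}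

end Advice

namespace Advice

/-! Upper bound in (a): if `f` has a rational zero, the advice is a code of one. Otherwise `f` has a
strict sign at every dyadic midpoint, a finite part of a name of `f` certifies this sign, and plain
bisection never stalls. There are countably many pieces of advice and one computable program,
`zeroProgram`.

Lower bound in (a): a program reads only finitely many entries before each output, and all functions
close to `g` have names sharing those entries with a name of `g`. So `k`-wise computability implies
`k`-continuity (`KComputable.kContinuous`), and it remains to refute finite covers. Suppose some
pieces are already excluded for functions in an open set `U` with all zeros in `[a, b]`. Some `g ∈
U` vanishes exactly on `[a, b]` and lies in a new piece `D`, where continuity singles out a zero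
`y`. Shrink to `[a', b']` missing `y`, and perturb `g` to vanish exactly there
(`VanishesOnIcc.exists_shrink`): near `g`, functions with all zeros in `[a', b']` are not in `D`. By
`infinite_of_extend` the cover is infinite.

Part (b) is the same diagonalization. Distances only grow when a set shrinks, so after any finite
part a name of `A` can continue as a name of a subset `B`. Hence a continuous realizer on `D` forces
a point common to all `B ⊆ A` in `D` (`realizer_common_value`). -/

/-! ### Names that survive splicing -/

theorem le_prefixCode_left (n : ℕ) (q : ℕ → ℕ) (k : ℕ) : n ≤ prefixCode n q k := by
  rw [prefixCode, Encodable.encode_list_cons]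
  exact (Nat.left_le_pair _ _).trans (Nat.le_succ _)

theorem le_prefixCode_right (n : ℕ) (q : ℕ → ℕ) (k : ℕ) : k ≤ prefixCode n q k := by
  have := Encodable.length_le_encode (n :: (List.range k).map q)
  simp only [List.length_cons, List.length_map, List.length_range] at this
  exact (Nat.le_succ k).trans this

/-- A program that always finds an answer, read off as a Kleene application. -/
theorem exists_kApp {p q : ℕ → ℕ} (h : ∀ n, ∃ k, p (prefixCode n q k) ≠ 0) :
    ∃ r, KApp p q r ∧ ∀ n, ∃ k, p (prefixCode n q k) = r n + 1 := by
  classical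
  have key : ∀ n, p (prefixCode n q (Nat.find (h n))) =
      p (prefixCode n q (Nat.find (h n))) - 1 + 1 := fun n => by
    have := Nat.find_spec (h n)
    omega
  exact ⟨fun n => p (prefixCode n q (Nat.find (h n))) - 1,
    fun n => ⟨_, key n, fun j hj => not_not.1 (Nat.find_min (h n) hj)⟩, fun n => ⟨_, key n⟩⟩

/-- A name of `g` all of whose answers, not only the first ones, are lower approximations with
error at most `2 ^ (-n - 1)`, and which answers on all sufficiently long prefixes. -/
structure RobustName {X : Type} (i g : X → ℝ) (p : ℕ → ℕ) : Prop where
  good : ∀ n q x k c, IsCauchyName q (i x) → p (prefixCode n q k) = c + 1 →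
    (ratOf c : ℝ) ≤ g x ∧ g x ≤ (ratOf c : ℝ) + (1 / 2 : ℝ) ^ (n + 1)
  answers : ∀ n q x, IsCauchyName q (i x) → ∃ m, ∀ k ≥ m, p (prefixCode n q k) ≠ 0

theorem exists_robustName {X : Type} [TopologicalSpace X] {i : X → ℝ} (hi : IsInducing i)
    {g : X → ℝ} (hg : Continuous g) : ∃ p, RobustName i g p := by
  classical
  -- An answer must suit every point compatible with the prefix read, not just the point being
  -- named.
  let good : ℕ → List ℕ → ℕ → Prop := fun n u c =>
    ∀ x, (∀ k (hk : k < u.length), |i x - (ratOf u[k] : ℝ)| ≤ (1 / 2 : ℝ) ^ k) →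
      (ratOf c : ℝ) ≤ g x ∧ g x ≤ (ratOf c : ℝ) + (1 / 2 : ℝ) ^ (n + 1)
  let val : List ℕ → ℕ := fun l =>
    match l with
    | [] => 0
    | n :: u => if h : ∃ c, good n u c then h.choose + 1 else 0
  let p : ℕ → ℕ := fun m => ((Encodable.decode (α := List ℕ) m).map val).getD 0
  have hp : ∀ n q k, p (prefixCode n q k) =
      if h : ∃ c, good n ((List.range k).map q) c then h.choose + 1 else 0 := by
    intro n q k
    simp [p, prefixCode, val]
  refine ⟨p, ?_, ?_⟩
  · intro n q x k c hq hc
    rw [hp] at hc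
    split_ifs at hc with h
    obtain rfl : h.choose = c := by omega
    exact h.choose_spec x fun j hj => by simpa using hq j
  · intro n q x hq
    obtain ⟨c, hc1, hc2⟩ := exists_lower (g x) (n + 1)
    have hU : {y | (ratOf c : ℝ) < g y ∧ g y < (ratOf c : ℝ) + (1 / 2 : ℝ) ^ (n + 1)} ∈ 𝓝 x :=
      hg.continuousAt (Ioo_mem_nhds hc1 hc2)
    rw [hi.nhds_eq_comap] at hU
    obtain ⟨W, hW, hWU⟩ := hU
    obtain ⟨ε, hε, hball⟩ := Metric.mem_nhds_iff.1 hW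
    obtain ⟨m, hm⟩ := exists_pow_lt_of_lt_one (show (0 : ℝ) < ε / 2 by linarith)
      (show (1 / 2 : ℝ) < 1 by norm_num)
    refine ⟨m + 1, fun k hk => ?_⟩
    rw [hp, dif_pos]
    · omega
    · refine ⟨c, fun y hy => ?_⟩
      have h1 := abs_le.1 (hy m (by simpa using hk))
      have h2 := abs_le.1 (hq m)
      simp only [List.getElem_map, List.getElem_range] at h1
      have : i y ∈ Metric.ball (i x) ε := by
        rw [Metric.mem_ball, Real.dist_eq]
        exact abs_lt.2 ⟨by linarith [h1.1, h2.2], by linarith [h1.2, h2.1]⟩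
      have := hWU (show y ∈ i ⁻¹' W from hball this)
      exact ⟨this.1.le, this.2.le⟩

/-- The sequence which agrees with `p` below `K` and with `p'` from `K` on. -/
def splice (K : ℕ) (p p' : ℕ → ℕ) : ℕ → ℕ := fun m => if m < K then p m else p' m

theorem splice_of_lt {K m : ℕ} (h : m < K) (p p' : ℕ → ℕ) : splice K p p' m = p m := if_pos h

/-- A prefix code is at least `n` and at least the prefix length. So `p` can answer only when `n <
K`, and long prefixes are left to `p'`. The first answer of the splice need not be the first answer
of `p` or of `p'`, which is why every answer has to be good. -/
theorem RobustName.splice {X : Type} {i g g' : X → ℝ} {p p' : ℕ → ℕ} (h : RobustName i g p)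
    (h' : RobustName i g' p') (K : ℕ) {q : ℕ → ℕ} {x : X} (hq : IsCauchyName q (i x)) :
    ∃ r, KApp (splice K p p') q r ∧ ∀ n,
      (n < K ∧ (ratOf (r n) : ℝ) ≤ g x ∧ g x ≤ (ratOf (r n) : ℝ) + (1 / 2 : ℝ) ^ (n + 1)) ∨
      ((ratOf (r n) : ℝ) ≤ g' x ∧ g' x ≤ (ratOf (r n) : ℝ) + (1 / 2 : ℝ) ^ (n + 1)) := by
  obtain ⟨r, hr, hr'⟩ := exists_kApp (p := Advice.splice K p p') (q := q) fun n => by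
    obtain ⟨m, hm⟩ := h'.answers n q x hq
    refine ⟨max m K, ?_⟩
    rw [Advice.splice, if_neg]
    · exact hm _ (le_max_left _ _)
    · exact not_lt.2 ((le_max_right m K).trans (le_prefixCode_right _ _ _))
  refine ⟨r, hr, fun n => ?_⟩
  obtain ⟨k, hk⟩ := hr' n
  rw [Advice.splice] at hk
  split_ifs at hk with hlt
  · exact Or.inl ⟨(le_prefixCode_left _ _ _).trans_lt hlt, h.good n q x k _ hq hk⟩
  · exact Or.inr (h'.good n q x k _ hq hk)

/-- Robust names use only half of the allowed error; the other half absorbs the distance from `f` to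
`g` in those outputs, all with `n < K`, that come from `p`. -/
theorem contRep_name_splice {f g : C(unitInterval, ℝ)} {p p' : ℕ → ℕ}
    (h : RobustName (Subtype.val : unitInterval → ℝ) f p)
    (h' : RobustName (Subtype.val : unitInterval → ℝ) g p') {K : ℕ}
    (hd : dist g f ≤ (1 / 2 : ℝ) ^ (K + 1)) : contRep.Name (splice K p p') g := by
  intro q x hq
  obtain ⟨r, hr, hr'⟩ := h.splice h' K hq
  refine ⟨r, hr, fun n => ?_⟩
  have hn : (1 / 2 : ℝ) ^ (n + 1) = (1 / 2 : ℝ) ^ n / 2 := by ring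
  have h0 : (0 : ℝ) < (1 / 2 : ℝ) ^ n := by positivity
  rcases hr' n with ⟨hlt, h1, h2⟩ | ⟨h1, h2⟩
  · have h3 : (1 / 2 : ℝ) ^ (K + 1) ≤ (1 / 2 : ℝ) ^ (n + 1) :=
      pow_le_pow_of_le_one (by norm_num) (by norm_num) (by omega)
    have h4 := abs_le.1 ((Real.dist_eq _ _ ▸ ContinuousMap.dist_apply_le_dist x).trans (hd.trans h3))
    exact abs_le.2 ⟨by linarith [h4.1], by linarith [h4.2]⟩
  · exact abs_le.2 ⟨by linarith, by linarith⟩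

theorem RobustName.contRep_name {f : C(unitInterval, ℝ)} {p : ℕ → ℕ}
    (h : RobustName (Subtype.val : unitInterval → ℝ) f p) : contRep.Name p f := by
  have := contRep_name_splice (K := 0) h h (by simp)
  exact this

/-- No closeness of `A` and `B` is needed: lower bounds for the distance to `A` are lower bounds for
the distance to `B`, and the outputs with `n ≥ K` alone already have the right supremum. -/
theorem psiGreater_name_splice {A B : ClosedSets} {p p' : ℕ → ℕ}
    (h : RobustName id (fun x => Metric.infDist x A.1) p)
    (h' : RobustName id (fun x => Metric.infDist x B.1) p') (hBA : B.1 ⊆ A.1) (K : ℕ) :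
    psiGreater.Name (splice K p p') B := by
  intro q x hq
  obtain ⟨r, hr, hr'⟩ := h.splice h' K (x := x) hq
  refine ⟨r, hr, ?_, fun b hb => ?_⟩
  · rintro _ ⟨n, rfl⟩
    rcases hr' n with ⟨-, h1, -⟩ | ⟨h1, -⟩
    · exact h1.trans (Metric.infDist_le_infDist_of_subset hBA B.2.2)
    · exact h1
  · have lim : Filter.Tendsto (fun n : ℕ => b + (1 / 2 : ℝ) ^ (n + 1)) Filter.atTop (𝓝 (b + 0)) :=
      ((tendsto_pow_atTop_nhds_zero_of_lt_one (by norm_num) (by norm_num)).comp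
        (Filter.tendsto_add_atTop_nat 1)).const_add b
    rw [add_zero] at lim
    refine ge_of_tendsto lim (Filter.eventually_atTop.2 ⟨K, fun n hn => ?_⟩)
    have hb' : (ratOf (r n) : ℝ) ≤ b := hb ⟨n, rfl⟩
    rcases hr' n with ⟨hlt, -⟩ | ⟨-, h2⟩
    · omega
    · exact h2.trans (by linarith)

/-! ### Selecting a point of an interval -/

/-- The point is the one the realizer selects from a robust name of `A`. Splices of this name into
names of `B` converge to it, so the selected points of `B` come arbitrarily close to `y`, and `B` is
closed. -/
theorem realizer_common_value {D : Set ClosedSets}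
    (hD : HasContinuousRealizerOn psiGreater realRep Select D) {A : ClosedSets} (hA : A ∈ D) :
    ∃ y ∈ A.1, ∀ B ∈ D, B.1 ⊆ A.1 → y ∈ B.1 := by
  obtain ⟨F, hF, hFD⟩ := hD
  have hdist : ∀ C : ClosedSets, ∃ p, RobustName id (fun x => Metric.infDist x C.1) p := fun C =>
    exists_robustName IsInducing.id (Metric.continuous_infDist_pt C.1)
  obtain ⟨p, hp⟩ := hdist A
  have hpA : psiGreater.Name p A := psiGreater_name_splice (K := 0) hp hp subset_rfl
  obtain ⟨y, hy, hFy⟩ := hFD A hA p hpA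
  refine ⟨y, hy.2, fun B hB hBA => ?_⟩
  obtain ⟨p', hp'⟩ := hdist B
  have hs := fun K => psiGreater_name_splice hp hp' hBA K
  choose z hz hFz using fun K => hFD B hB _ (hs K)
  have hlim : Filter.Tendsto (fun K => splice K p p') Filter.atTop
      (𝓝[{q | ∃ a ∈ D, psiGreater.Name q a}] p) := by
    refine tendsto_nhdsWithin_iff.2 ⟨tendsto_pi_nhds.2 fun m => ?_,
      Filter.Eventually.of_forall fun K => ⟨B, hB, hs K⟩⟩
    refine tendsto_const_nhds.congr' (Filter.eventually_atTop.2 ⟨m + 1, fun K hK => ?_⟩)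
    exact (splice_of_lt (by omega) p p').symm
  have hFlim := (hF p ⟨A, hA, hpA⟩).tendsto.comp hlim
  rw [← B.2.1.closure_eq]
  refine Metric.mem_closure_iff.2 fun ε hε => ?_
  obtain ⟨n, hn⟩ := exists_pow_lt_of_lt_one (show (0 : ℝ) < ε / 2 by linarith)
    (show (1 / 2 : ℝ) < 1 by norm_num)
  -- Convergence in Baire space makes each single output eventually constant.
  have hev : ∀ᶠ K in Filter.atTop, F (splice K p p') n = F p n :=
    (tendsto_pi_nhds.1 hFlim n).eventually (mem_nhds_discrete.2 rfl : {F p n} ∈ 𝓝 (F p n))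
  obtain ⟨K, hK⟩ := hev.exists
  refine ⟨z K, (hz K).2, ?_⟩
  have h1 := abs_le.1 (show |y - (ratOf (F p n) : ℝ)| ≤ (1 / 2 : ℝ) ^ n from hFy n)
  have h2 := abs_le.1
    (show |z K - (ratOf (F (splice K p p') n) : ℝ)| ≤ (1 / 2 : ℝ) ^ n from hFz K n)
  rw [hK] at h2
  rw [Real.dist_eq]
  exact abs_lt.2 ⟨by linarith [h1.1, h2.2], by linarith [h1.2, h2.1]⟩

/-- The diagonal scheme of both lower bounds: `P S` will say that the members of `S` are excluded on
some remaining stock of instances. -/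
theorem infinite_of_extend {α : Type*} [DecidableEq α] {Δ : Set α} {P : Finset α → Prop}
    (h0 : P ∅)
    (h : ∀ S : Finset α, (S : Set α) ⊆ Δ → P S → ∃ D ∈ Δ, D ∉ S ∧ P (insert D S)) :
    Δ.Infinite := by
  intro hfin
  have key : ∀ n, ∃ S : Finset α, (S : Set α) ⊆ Δ ∧ P S ∧ S.card = n := by
    intro n
    induction n with
    | zero => exact ⟨∅, by simp, h0, rfl⟩
    | succ n ih =>
      obtain ⟨S, hS, hP, hc⟩ := ih
      obtain ⟨D, hD, hDS, hP'⟩ := h S hS hP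
      refine ⟨insert D S, ?_, hP', by rw [Finset.card_insert_of_notMem hDS, hc]⟩
      rw [Finset.coe_insert]
      exact Set.insert_subset hD hS
  obtain ⟨S, hS, -, hc⟩ := key (hfin.toFinset.card + 1)
  have : S ⊆ hfin.toFinset := fun x hx => hfin.mem_toFinset.2 (hS hx)
  have := Finset.card_le_card this
  omega

theorem exists_Icc_notMem {a b : ℝ} (hab : a < b) (y : ℝ) :
    ∃ a' b', a ≤ a' ∧ a' < b' ∧ b' ≤ b ∧ y ∉ Set.Icc a' b' := by
  rcases le_or_gt y ((a + b) / 2) with h | h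
  -- The last quarter, since `y` may be the midpoint itself.
  · exact ⟨(a + 3 * b) / 4, b, by linarith, by linarith, le_rfl, fun hy => by linarith [hy.1]⟩
  · exact ⟨a, (a + b) / 2, le_rfl, by linarith, by linarith, fun hy => by linarith [hy.2]⟩

theorem not_kwiseContinuous_select (d : ℕ) :
    ¬ KwiseContinuous psiGreater realRep Select (d : Cardinal) := by
  classical
  rintro ⟨Δ, ⟨hcov, -, -⟩, hcard, hΔ⟩
  have hfin : Δ.Finite :=
    Cardinal.lt_aleph0_iff_set_finite.1 (hcard ▸ Cardinal.natCast_lt_aleph0)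
  refine infinite_of_extend (Δ := Δ) (P := fun S => ∃ a b : ℝ, 0 ≤ a ∧ a < b ∧ b ≤ 1 ∧
    ∀ B : ClosedSets, B.1 ⊆ Set.Icc a b → ∀ D ∈ S, B ∉ D)
    ⟨0, 1, le_rfl, one_pos, le_rfl, by simp⟩ ?_ hfin
  rintro S - ⟨a, b, ha, hab, hb, hS⟩
  let J : ClosedSets := ⟨Set.Icc a b, isClosed_Icc, Set.nonempty_Icc.2 hab.le⟩
  have hJ : J ∈ mdom Select := ⟨a, ⟨a, b, ha, hab, hb, rfl⟩, Set.left_mem_Icc.2 hab.le⟩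
  rw [← hcov] at hJ
  obtain ⟨D, hD, hJD⟩ := hJ
  obtain ⟨y, -, hy⟩ := realizer_common_value (hΔ D hD) hJD
  obtain ⟨a', b', haa', hab', hbb', hy'⟩ := exists_Icc_notMem hab y
  have hsub : Set.Icc a' b' ⊆ Set.Icc a b := Set.Icc_subset_Icc haa' hbb'
  -- `D` is new because `J` lies in it, while the invariant keeps `J` out of every member of `S`.
  refine ⟨D, hD, fun h => hS J subset_rfl D h hJD, a', b', ha.trans haa', hab', hbb'.trans hb,
    fun B hB E hE hBE => ?_⟩
  rcases Finset.mem_insert.1 hE with rfl | hE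
  · exact hy' (hB (hy B hBE (hB.trans hsub)))
  · exact hS B (hB.trans hsub) E hE hBE

/-! ### Discontinuity of zero-finding -/

theorem kApp_apply_eq {t q q' r r' : ℕ → ℕ} {n k : ℕ} (hk : t (prefixCode n q k) = r n + 1)
    (hk0 : ∀ j < k, t (prefixCode n q j) = 0) (hqq' : ∀ j < k, q j = q' j) (h : KApp t q' r') :
    r' n = r n := by
  have hpre : ∀ j ≤ k, prefixCode n q' j = prefixCode n q j := fun j hj => by
    rw [prefixCode, prefixCode]
    congr 2
    refine List.map_congr_left fun l hl => (hqq' l ?_).symm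
    have := List.mem_range.1 hl
    omega
  obtain ⟨l, hl, hl0⟩ := h n
  rcases lt_trichotomy l k with hlk | rfl | hlk
  · have := hk0 l hlk
    rw [hpre l hlk.le] at hl
    omega
  · rw [hpre l le_rfl] at hl
    omega
  · have := hl0 k hlk
    rw [hpre k le_rfl] at this
    omega

/-- The same partition works. With the advice for `D` fixed, the `n`-th output at `g` depends on the
first `K` inputs, and every function within `2 ^ (-K - 1)` of `g` has a name agreeing with these. -/
theorem KComputable.kContinuous {f : C(unitInterval, ℝ) → Set unitInterval} {k : Cardinal}
    (h : KComputable contRep unitRep f k) : KContinuous f k := by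
  obtain ⟨Δ, ⟨hcov, -, -⟩, -, hcard, δ, hδ, t, -, ht⟩ := h
  refine ⟨Δ, hcov, hcard, fun D hD g hg => ?_⟩
  obtain ⟨i, hi⟩ : ∃ i, D ∈ δ i := by
    rw [← hδ] at hD
    exact hD
  obtain ⟨p, hp⟩ := exists_robustName (IsInducing.subtypeVal (t := unitInterval)) g.continuous
  obtain ⟨r, hr, y, hy, hry⟩ := ht i D g p hi hg hp.contRep_name
  refine ⟨y, hy, fun V hV hyV => ?_⟩
  obtain ⟨ε, hε, hball⟩ := Metric.isOpen_iff.1 hV y hyV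
  obtain ⟨n, hn⟩ := exists_pow_lt_of_lt_one (show (0 : ℝ) < ε / 2 by linarith)
    (show (1 / 2 : ℝ) < 1 by norm_num)
  obtain ⟨K, hK, hK0⟩ := hr n
  refine ⟨Metric.ball g ((1 / 2 : ℝ) ^ (K + 1)), Metric.ball_mem_nhds _ (by positivity), ?_⟩
  rintro z ⟨hzg, hz⟩
  obtain ⟨p', hp'⟩ :=
    exists_robustName (IsInducing.subtypeVal (t := unitInterval)) z.continuous
  obtain ⟨r', hr', y', hy', hry'⟩ := ht i D z _ hi hz
    (contRep_name_splice hp hp' (K := K) (Metric.mem_ball.1 hzg).le)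
  refine ⟨y', hy', hball ?_⟩
  have hrn : r' n = r n := kApp_apply_eq hK hK0 (fun j hj => by
    cases j with
    | zero => rfl
    | succ j => exact (splice_of_lt (by omega) p p').symm) hr'
  have h1 := abs_le.1 (show |(y : ℝ) - (ratOf (r n) : ℝ)| ≤ (1 / 2 : ℝ) ^ n from hry n)
  have h2 := abs_le.1 (show |(y' : ℝ) - (ratOf (r' n) : ℝ)| ≤ (1 / 2 : ℝ) ^ n from hry' n)
  rw [hrn] at h2
  rw [Metric.mem_ball, Subtype.dist_eq, Real.dist_eq]
  exact abs_lt.2 ⟨by linarith [h1.2, h2.1], by linarith [h1.1, h2.2]⟩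

/-- `g` is an instance of the zero-finding problem, negative to the left of `[a, b]`, zero on
`[a, b]` and positive to the right of it. -/
structure VanishesOnIcc (g : C(unitInterval, ℝ)) (a b : ℝ) : Prop where
  bounds : ∀ t, g t ∈ Set.Icc (-1 : ℝ) 1
  left : g 0 = -1
  right : g 1 = 1
  neg : ∀ t : unitInterval, (t : ℝ) < a → g t < 0
  zero : ∀ t : unitInterval, (t : ℝ) ∈ Set.Icc a b → g t = 0
  pos : ∀ t : unitInterval, b < (t : ℝ) → 0 < g t

theorem VanishesOnIcc.eq_zero_iff {g : C(unitInterval, ℝ)} {a b : ℝ} (h : VanishesOnIcc g a b)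
    (t : unitInterval) : g t = 0 ↔ (t : ℝ) ∈ Set.Icc a b := by
  refine ⟨fun ht => ⟨not_lt.1 fun hlt => ?_, not_lt.1 fun hlt => ?_⟩, h.zero t⟩
  · exact (h.neg t hlt).ne ht
  · exact (h.pos t hlt).ne' ht

theorem exists_vanishesOnIcc : ∃ g, VanishesOnIcc g (1 / 3) (2 / 3) := by
  refine ⟨⟨fun t => max (3 * (t : ℝ) - 2) 0 - max (1 - 3 * (t : ℝ)) 0, by fun_prop⟩,
    ?_, ?_, ?_, ?_, ?_, ?_⟩
  · intro t
    have h0 := t.2.1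
    have h1 := t.2.2
    simp only [ContinuousMap.coe_mk, Set.mem_Icc]
    constructor <;> rcases max_cases (3 * (t : ℝ) - 2) 0 with h | h <;>
      rcases max_cases (1 - 3 * (t : ℝ)) 0 with h' | h' <;> linarith
  · norm_num
  · norm_num
  all_goals
    intro t ht
    simp only [ContinuousMap.coe_mk, Set.mem_Icc] at ht ⊢
    rcases max_cases (3 * (t : ℝ) - 2) 0 with h | h <;>
      rcases max_cases (1 - 3 * (t : ℝ)) 0 with h' | h' <;> linarith

/-- Add `ε * w`, where `w` has exactly the desired sign pattern. The signs of `g` agree weakly with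
it, so no cancellation occurs. Clamping to `[-1, 1]` keeps signs and restores the boundary values.
-/
theorem VanishesOnIcc.exists_shrink {g : C(unitInterval, ℝ)} {a b a' b' ε : ℝ}
    (h : VanishesOnIcc g a b) (haa' : a ≤ a') (hab' : a' < b') (hbb' : b' ≤ b) (ha : 0 < a)
    (hb : b < 1) (hε : 0 < ε) : ∃ g', VanishesOnIcc g' a' b' ∧ dist g' g ≤ ε := by
  let w : unitInterval → ℝ := fun t => max ((t : ℝ) - b') 0 - max (a' - (t : ℝ)) 0
  have hw : Continuous w := by fun_prop
  have hw1 : ∀ t, |w t| ≤ 1 := by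
    intro t
    have h0 := t.2.1
    have h1 := t.2.2
    refine abs_le.2 ?_
    simp only [w]
    constructor <;> rcases max_cases ((t : ℝ) - b') 0 with h | h <;>
      rcases max_cases (a' - (t : ℝ)) 0 with h' | h' <;> linarith
  have hwneg : ∀ t : unitInterval, (t : ℝ) < a' → w t < 0 := by
    intro t ht
    simp only [w]
    rw [max_eq_right (by linarith), max_eq_left (by linarith)]
    linarith
  have hwzero : ∀ t : unitInterval, (t : ℝ) ∈ Set.Icc a' b' → w t = 0 := by
    intro t ht
    simp only [w]
    rw [max_eq_right (by linarith [ht.2]), max_eq_right (by linarith [ht.1]), sub_zero]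
  have hwpos : ∀ t : unitInterval, b' < (t : ℝ) → 0 < w t := by
    intro t ht
    simp only [w]
    rw [max_eq_left (by linarith), max_eq_right (by linarith)]
    linarith
  have hg0 : ∀ t : unitInterval, (t : ℝ) ≤ b → g t ≤ 0 := fun t ht => by
    rcases lt_or_ge (t : ℝ) a with hta | hta
    · exact (h.neg t hta).le
    · exact (h.zero t ⟨hta, ht⟩).le
  have hg1 : ∀ t : unitInterval, a ≤ (t : ℝ) → 0 ≤ g t := fun t ht => by
    rcases lt_or_ge b (t : ℝ) with hta | hta
    · exact (h.pos t hta).le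
    · exact (h.zero t ⟨ht, hta⟩).ge
  have h00 : ((0 : unitInterval) : ℝ) = 0 := rfl
  have h11 : ((1 : unitInterval) : ℝ) = 1 := rfl
  let G : C(unitInterval, ℝ) := ⟨fun t => max (-1) (min 1 (g t + ε * w t)), by fun_prop⟩
  have hG : ∀ t, G t = max (-1) (min 1 (g t + ε * w t)) := fun t => rfl
  refine ⟨G, ⟨?_, ?_, ?_, ?_, ?_, ?_⟩, ?_⟩
  · intro t
    exact ⟨le_max_left _ _, max_le (by norm_num) (min_le_left _ _)⟩
  · have := mul_neg_of_pos_of_neg hε (hwneg 0 (by linarith))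
    rw [hG, h.left, max_eq_left]
    exact (min_le_right _ _).trans (by linarith)
  · have := mul_pos hε (hwpos 1 (by linarith))
    rw [hG, h.right, min_eq_left (by linarith)]
    norm_num
  · intro t ht
    have := mul_neg_of_pos_of_neg hε (hwneg t ht)
    have := hg0 t (by linarith)
    rw [hG]
    exact max_lt (by norm_num) ((min_le_right _ _).trans_lt (by linarith))
  · intro t ht
    rw [hG, hwzero t ht, h.zero t ⟨haa'.trans ht.1, ht.2.trans hbb'⟩]
    norm_num
  · intro t ht
    have := mul_pos hε (hwpos t ht)
    have := hg1 t (by linarith)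
    rw [hG]
    exact lt_max_of_lt_right (lt_min one_pos (by linarith))
  · refine (ContinuousMap.dist_le hε.le).2 fun t => ?_
    -- Clamping fixes `g` and is 1-Lipschitz, so it does not increase the distance.
    have hgt : g t = max (-1) (min 1 (g t)) := by
      rw [min_eq_right (h.bounds t).2, max_eq_right (h.bounds t).1]
    have hεw : |ε * w t| ≤ ε := by
      rw [abs_mul, abs_of_pos hε]
      exact mul_le_of_le_one_right hε.le (hw1 t)
    rw [Real.dist_eq, hG]
    calc |max (-1) (min 1 (g t + ε * w t)) - g t|
        = |max (-1) (min 1 (g t + ε * w t)) - max (-1) (min 1 (g t))| := by rw [← hgt]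
      _ ≤ |min 1 (g t + ε * w t) - min 1 (g t)| :=
        (abs_max_sub_max_le_max _ _ _ _).trans (max_le (by simp) le_rfl)
      _ ≤ |(g t + ε * w t) - g t| :=
        (abs_min_sub_min_le_max _ _ _ _).trans
          (max_le (by rw [sub_self, abs_zero]; exact abs_nonneg _) le_rfl)
      _ ≤ ε := by rwa [add_sub_cancel_left]

theorem not_kContinuous_intermed (d : ℕ) : ¬ KContinuous Intermed (d : Cardinal) := by
  classical
  rintro ⟨Δ, hcov, hcard, hΔ⟩
  have hfin : Δ.Finite :=
    Cardinal.lt_aleph0_iff_set_finite.1 (hcard ▸ Cardinal.natCast_lt_aleph0)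
  refine infinite_of_extend (Δ := Δ) (P := fun S => ∃ (U : Set C(unitInterval, ℝ)) (g : _)
    (a b : ℝ), IsOpen U ∧ g ∈ U ∧ 0 < a ∧ a < b ∧ b < 1 ∧ VanishesOnIcc g a b ∧
      ∀ h ∈ U, (∀ t, h t = 0 → (t : ℝ) ∈ Set.Icc a b) → ∀ D ∈ S, h ∉ D) ?_ ?_ hfin
  · obtain ⟨g, hg⟩ := exists_vanishesOnIcc
    exact ⟨Set.univ, g, 1 / 3, 2 / 3, isOpen_univ, trivial, by norm_num, by norm_num, by norm_num,
      hg, by simp⟩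
  rintro S - ⟨U, g, a, b, hU, hgU, ha, hab, hb, hg, hS⟩
  have hgdom : g ∈ mdom Intermed :=
    ⟨⟨a, ha.le, by linarith⟩, ⟨hg.bounds, hg.left, hg.right⟩,
      hg.zero _ (Set.left_mem_Icc.2 hab.le)⟩
  rw [← hcov] at hgdom
  obtain ⟨D, hD, hgD⟩ := hgdom
  obtain ⟨y, hy, hyV⟩ := hΔ D hD g hgD
  obtain ⟨a', b', haa', hab', hbb', hy'⟩ := exists_Icc_notMem hab (y : ℝ)
  -- Members of `D` near `g` must have a zero outside `[a', b']`.
  obtain ⟨W, hW, hWV⟩ := hyV {t | (t : ℝ) ∉ Set.Icc a' b'}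
    (isClosed_Icc.isOpen_compl.preimage continuous_subtype_val) hy'
  obtain ⟨W', hW'W, hW', hgW'⟩ := mem_nhds_iff.1 hW
  obtain ⟨ε, hε, hball⟩ := Metric.isOpen_iff.1 (hU.inter hW') g ⟨hgU, hgW'⟩
  obtain ⟨g', hg', hdist⟩ := hg.exists_shrink haa' hab' hbb' ha hb (half_pos hε)
  have hsub : Set.Icc a' b' ⊆ Set.Icc a b := Set.Icc_subset_Icc haa' hbb'
  refine ⟨D, hD, fun h => hS g hgU (fun t ht => (hg.eq_zero_iff t).1 ht) D h hgD, U ∩ W', g', a',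
    b', hU.inter hW', hball (Metric.mem_ball.2 (by linarith)), ha.trans_le haa', hab',
    hbb'.trans_lt hb, hg', fun h hh hz E hE hhE => ?_⟩
  rcases Finset.mem_insert.1 hE with rfl | hE
  · obtain ⟨t, ht, htV⟩ := hWV h ⟨hW'W hh.2, hhE⟩
    exact htV (hz t ht.2)
  · exact hS h hh.1 (fun t ht => hsub (hz t ht)) E hE hhE

/-! ### Bisection -/

/-- The certificate that the rational coded by `v`, as an approximation with error `2 ^ (-e)`,
belongs to a negative number. -/
def NegTest (e v : ℕ) : Prop :=
  2 ^ e * v.unpair.1.unpair.1 + (v.unpair.2 + 1) < 2 ^ e * v.unpair.1.unpair.2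

/-- The certificate that the rational coded by `v`, as an approximation with error `2 ^ (-e)`,
belongs to a positive number. -/
def PosTest (e v : ℕ) : Prop :=
  2 ^ e * v.unpair.1.unpair.2 + (v.unpair.2 + 1) < 2 ^ e * v.unpair.1.unpair.1

/-- Clearing denominators and moving the negative term across gives a test in natural-number
arithmetic, hence a primitive recursive one. -/
theorem negTest_iff (e v : ℕ) : NegTest e v ↔ (ratOf v : ℝ) + (1 / 2 : ℝ) ^ e < 0 := by
  have h2 : (0 : ℝ) < 2 ^ e := by positivity
  have hc : (0 : ℝ) < (v.unpair.2 : ℝ) + 1 := by positivity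
  have key : (ratOf v : ℝ) + (1 / 2 : ℝ) ^ e =
      (2 ^ e * (v.unpair.1.unpair.1 : ℝ) + (v.unpair.2 + 1) - 2 ^ e * v.unpair.1.unpair.2) /
        (2 ^ e * (v.unpair.2 + 1)) := by
    simp only [ratOf, one_div, inv_pow]
    push_cast
    field_simp
    ring
  rw [key, div_lt_iff₀ (by positivity), zero_mul, sub_neg, NegTest]
  exact_mod_cast Iff.rfl

theorem posTest_iff (e v : ℕ) : PosTest e v ↔ 0 < (ratOf v : ℝ) - (1 / 2 : ℝ) ^ e := by
  have h2 : (0 : ℝ) < 2 ^ e := by positivity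
  have hc : (0 : ℝ) < (v.unpair.2 : ℝ) + 1 := by positivity
  have key : (ratOf v : ℝ) - (1 / 2 : ℝ) ^ e =
      (2 ^ e * (v.unpair.1.unpair.1 : ℝ) - (2 ^ e * v.unpair.1.unpair.2 + (v.unpair.2 + 1))) /
        (2 ^ e * (v.unpair.2 + 1)) := by
    simp only [ratOf, one_div, inv_pow]
    push_cast
    field_simp
    ring
  rw [key, lt_div_iff₀ (by positivity), zero_mul, sub_pos, PosTest]
  exact_mod_cast Iff.rfl

/-- The finite part `L` of a program, run on the constant input `c`, gives for some `e` an answer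
that passes the test `T e`. -/
def Certifies (T : ℕ → ℕ → Prop) (L : List ℕ) (c : ℕ) : Prop :=
  ∃ e < L.length, ∃ k < L.length,
    (0 < L[prefixCode e (fun _ => c) k]?.getD 0 ∧
      T e (L[prefixCode e (fun _ => c) k]?.getD 0 - 1)) ∧
    ∀ j < k, L[prefixCode e (fun _ => c) j]? = some 0

theorem primrec_pow : Primrec₂ ((· ^ ·) : ℕ → ℕ → ℕ) :=
  Primrec₂.unpaired'.1 Nat.Primrec.pow

theorem primrec_unpair_fst {α : Type*} [Primcodable α] {f : α → ℕ} (hf : Primrec f) :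
    Primrec fun a => (f a).unpair.1 := Primrec.fst.comp (Primrec.unpair.comp hf)

theorem primrec_unpair_snd {α : Type*} [Primcodable α] {f : α → ℕ} (hf : Primrec f) :
    Primrec fun a => (f a).unpair.2 := Primrec.snd.comp (Primrec.unpair.comp hf)

theorem primrec_negTest : PrimrecRel NegTest :=
  Primrec.nat_lt.comp
    (Primrec.nat_add.comp
      (Primrec.nat_mul.comp (primrec_pow.comp (Primrec.const 2) Primrec.fst)
        (primrec_unpair_fst (primrec_unpair_fst Primrec.snd)))
      (Primrec.succ.comp (primrec_unpair_snd Primrec.snd)))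
    (Primrec.nat_mul.comp (primrec_pow.comp (Primrec.const 2) Primrec.fst)
      (primrec_unpair_snd (primrec_unpair_fst Primrec.snd)))

theorem primrec_posTest : PrimrecRel PosTest :=
  Primrec.nat_lt.comp
    (Primrec.nat_add.comp
      (Primrec.nat_mul.comp (primrec_pow.comp (Primrec.const 2) Primrec.fst)
        (primrec_unpair_snd (primrec_unpair_fst Primrec.snd)))
      (Primrec.succ.comp (primrec_unpair_snd Primrec.snd)))
    (Primrec.nat_mul.comp (primrec_pow.comp (Primrec.const 2) Primrec.fst)
      (primrec_unpair_fst (primrec_unpair_fst Primrec.snd)))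

theorem primrec_prefixCode_const :
    Primrec fun x : (ℕ × ℕ) × ℕ => prefixCode x.1.1 (fun _ => x.1.2) x.2 :=
  Primrec.encode.comp (Primrec.list_cons.comp (Primrec.fst.comp Primrec.fst)
    (Primrec.list_map (Primrec.list_range.comp Primrec.snd)
      ((Primrec.snd.comp (Primrec.fst.comp Primrec.fst)).to₂)))

theorem PrimrecPred.exists_lt_of {α : Type*} [Primcodable α] {f : α → ℕ} {P : α → ℕ → Prop}
    (hf : Primrec f) (hP : PrimrecRel P) : PrimrecPred fun a => ∃ n < f a, P a n :=
  ((PrimrecRel.exists_mem_list (R := fun n a => P a n)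
    (hP.comp Primrec.snd Primrec.fst)).comp (Primrec.list_range.comp hf) Primrec.id).of_eq
      (by simp)

theorem PrimrecPred.forall_lt_of {α : Type*} [Primcodable α] {f : α → ℕ} {P : α → ℕ → Prop}
    (hf : Primrec f) (hP : PrimrecRel P) : PrimrecPred fun a => ∀ n < f a, P a n :=
  ((PrimrecRel.forall_mem_list (R := fun n a => P a n)
    (hP.comp Primrec.snd Primrec.fst)).comp (Primrec.list_range.comp hf) Primrec.id).of_eq
      (by simp)

/-- The search is bounded by the length of `L`, so every quantifier is a bounded one. -/
theorem primrec_certifies {T : ℕ → ℕ → Prop} (hT : PrimrecRel T) :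
    PrimrecRel (Certifies T) := by
  open Primrec in
  have hlook : Primrec fun x : ((List ℕ × ℕ) × ℕ) × ℕ =>
      x.1.1.1[prefixCode x.1.2 (fun _ => x.1.1.2) x.2]? :=
    list_getElem?.comp (fst.comp (fst.comp fst)) (primrec_prefixCode_const.comp
      (((snd.comp fst).pair (snd.comp (fst.comp fst))).pair snd))
  have hval : Primrec fun x : ((List ℕ × ℕ) × ℕ) × ℕ =>
      x.1.1.1[prefixCode x.1.2 (fun _ => x.1.1.2) x.2]?.getD 0 :=
    Primrec.option_getD.comp hlook (const 0)
  have h1 : PrimrecPred fun x : ((List ℕ × ℕ) × ℕ) × ℕ =>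
      0 < x.1.1.1[prefixCode x.1.2 (fun _ => x.1.1.2) x.2]?.getD 0 ∧
      T x.1.2 (x.1.1.1[prefixCode x.1.2 (fun _ => x.1.1.2) x.2]?.getD 0 - 1) :=
    (nat_lt.comp (const 0) hval).and
      (hT.comp (snd.comp fst) (nat_sub.comp hval (const 1)))
  have h2 : PrimrecPred fun x : ((List ℕ × ℕ) × ℕ) × ℕ =>
      ∀ j < x.2, x.1.1.1[prefixCode x.1.2 (fun _ => x.1.1.2) j]? = some 0 :=
    PrimrecPred.forall_lt_of snd
      (P := fun (x : ((List ℕ × ℕ) × ℕ) × ℕ) j =>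
        x.1.1.1[prefixCode x.1.2 (fun _ => x.1.1.2) j]? = some 0)
      (Primrec.eq.comp (hlook.comp ((fst.comp fst).pair snd)) (const (some 0)))
  have h3 : PrimrecPred fun x : (List ℕ × ℕ) × ℕ => ∃ k < x.1.1.length,
      (0 < x.1.1[prefixCode x.2 (fun _ => x.1.2) k]?.getD 0 ∧
      T x.2 (x.1.1[prefixCode x.2 (fun _ => x.1.2) k]?.getD 0 - 1)) ∧
      ∀ j < k, x.1.1[prefixCode x.2 (fun _ => x.1.2) j]? = some 0 :=
    PrimrecPred.exists_lt_of (list_length.comp (fst.comp fst)) (h1.and h2)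
  exact PrimrecPred.exists_lt_of (f := fun x : List ℕ × ℕ => x.1.length)
    (list_length.comp fst) h3

/-- The code of the dyadic rational `m / 2 ^ n`. -/
def dyadicCode (m n : ℕ) : ℕ := Nat.pair (Nat.pair m 0) (2 ^ n - 1)

theorem ratOf_dyadicCode (m n : ℕ) : (ratOf (dyadicCode m n) : ℝ) = (m : ℝ) / 2 ^ n := by
  have h : ((2 ^ n - 1 : ℕ) : ℝ) + 1 = 2 ^ n := by
    rw [Nat.cast_sub Nat.one_le_two_pow]
    simp
  simp only [ratOf, dyadicCode, Nat.unpair_pair]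
  push_cast
  rw [h]
  simp

theorem primrec_dyadicCode : Primrec₂ dyadicCode :=
  Primrec₂.natPair.comp (Primrec₂.natPair.comp Primrec.fst (Primrec.const 0))
    (Primrec.nat_sub.comp (primrec_pow.comp (Primrec.const 2) Primrec.snd) (Primrec.const 1))

open Classical in
/-- One step of the bisection with the finite part `L` of a name: from the interval
`[m / 2 ^ n, (m + 1) / 2 ^ n]` to one of its halves. -/
noncomputable def bisectStep (L : List ℕ) (n m : ℕ) : Option ℕ :=
  if Certifies NegTest L (dyadicCode (2 * m + 1) (n + 1)) then some (2 * m + 1)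
  else if Certifies PosTest L (dyadicCode (2 * m + 1) (n + 1)) then some (2 * m)
  else none

/-- The result of `n` steps of the bisection, as far as `L` allows. -/
noncomputable def bisect (L : List ℕ) : ℕ → Option ℕ
  | 0 => some 0
  | n + 1 => (bisect L n).bind (bisectStep L n)

theorem primrec_bisect : Primrec₂ bisect := by
  classical
  open Primrec in
  have hc : Primrec fun x : (List ℕ × ℕ) × ℕ => dyadicCode (2 * x.2 + 1) (x.1.2 + 1) :=
    primrec_dyadicCode.comp (succ.comp (nat_mul.comp (const 2) snd))
      (succ.comp (snd.comp fst))
  have hstep : Primrec fun x : (List ℕ × ℕ) × ℕ => bisectStep x.1.1 x.1.2 x.2 :=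
    Primrec.ite ((primrec_certifies primrec_negTest).comp (fst.comp fst) hc)
      (option_some.comp (succ.comp (nat_mul.comp (const 2) snd)))
      (Primrec.ite ((primrec_certifies primrec_posTest).comp (fst.comp fst) hc)
        (option_some.comp (nat_mul.comp (const 2) snd)) (const none))
  refine (Primrec.nat_rec (f := fun _ : List ℕ => some 0)
    (g := fun L (x : ℕ × Option ℕ) => x.2.bind (bisectStep L x.1)) (const _)
    (option_bind (snd.comp snd) (hstep.comp (((fst.comp fst).pair
      (fst.comp (snd.comp fst))).pair snd)))).of_eq fun L n => ?_
  induction n with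
  | zero => rfl
  | succ n ih => exact congrArg (fun o => Option.bind o (bisectStep L n)) ih

/-- The program for zero-finding on a list `n :: i :: L`, with advice `i`: advice `c + 1` is a code
of a rational zero, advice `0` promises that there are no rational zeros. -/
noncomputable def zeroProgramList (l : List ℕ) : ℕ :=
  if l.length < 2 then 0
  else if l.tail.headI = 0 then
    ((bisect l.tail.tail l.headI).map fun m => dyadicCode m l.headI + 1).getD 0
  else l.tail.headI

/-- Numbers that decode to nothing become the empty list, hence the answer `0`: read more. -/
noncomputable def zeroProgram (m : ℕ) : ℕ :=
  zeroProgramList ((Encodable.decode (α := List ℕ) m).getD [])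

theorem primrec_zeroProgram : Primrec zeroProgram := by
  open Primrec in
  have hl : Primrec zeroProgramList :=
    Primrec.ite (nat_lt.comp list_length (const 2)) (const 0)
      (Primrec.ite (Primrec.eq.comp (list_headI.comp list_tail) (const 0))
        (option_getD.comp (option_map (primrec_bisect.comp (list_tail.comp list_tail) list_headI)
          (succ.comp (primrec_dyadicCode.comp snd (list_headI.comp fst)))) (const 0))
        (list_headI.comp list_tail))
  exact hl.comp (option_getD.comp Primrec.decode (const []))

theorem zeroProgram_zero (n i : ℕ) (q : ℕ → ℕ) :
    zeroProgram (prefixCode n (consSeq i q) 0) = 0 := by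
  simp [zeroProgram, prefixCode, zeroProgramList]

/-- The advice occupies one of the `k + 1` entries read, leaving `k` for the name. An answer `i = c
+ 1` already means output `c`. -/
theorem zeroProgram_succ (n i : ℕ) (q : ℕ → ℕ) (k : ℕ) :
    zeroProgram (prefixCode n (consSeq i q) (k + 1)) = if i = 0 then
      ((bisect ((List.range k).map q) n).map fun m => dyadicCode m n + 1).getD 0 else i := by
  simp [zeroProgram, prefixCode, zeroProgramList, List.range_succ_eq_map, consSeq,
    Function.comp_def]

/-! ### Correctness of the certificates -/

theorem getElem?_map_range (p : ℕ → ℕ) (K m : ℕ) :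
    ((List.range K).map p)[m]? = if m < K then some (p m) else none := by
  split_ifs with h
  · simp [h]
  · simp [not_lt.1 h]

theorem isCauchyName_const (c : ℕ) : IsCauchyName (fun _ => c) (ratOf c : ℝ) := fun n => by
  rw [sub_self, abs_zero]
  positivity

/-- The constant sequence `c` names the point coded by `c`, and a certificate replays the actual run
of `p` on it, so the tested value is a genuine output. -/
theorem Certifies.sound {T : ℕ → ℕ → Prop} {p : ℕ → ℕ} {f : C(unitInterval, ℝ)}
    (hp : contRep.Name p f) {K c : ℕ} {x : unitInterval} (hx : (x : ℝ) = ratOf c)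
    (h : Certifies T ((List.range K).map p) c) :
    ∃ e v, |f x - (ratOf v : ℝ)| ≤ (1 / 2 : ℝ) ^ e ∧ T e v := by
  obtain ⟨r, hr, hrx⟩ := hp (fun _ => c) x
    (show IsCauchyName _ (x : ℝ) from hx ▸ isCauchyName_const c)
  obtain ⟨e, -, k, -, ⟨hpos, hT⟩, h0⟩ := h
  simp only [getElem?_map_range] at hpos hT h0
  -- An unread entry defaults to `0`, which is not an answer.
  have hk : prefixCode e (fun _ => c) k < K := by
    by_contra hk
    simp [hk] at hpos
  simp only [hk, if_true, Option.getD_some] at hpos hT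
  have hre : r e = p (prefixCode e (fun _ => c) k) - 1 :=
    kApp_apply_eq (r := fun _ => p (prefixCode e (fun _ => c) k) - 1)
      (Nat.succ_pred_eq_of_pos hpos).symm (fun j hj => by
        have := h0 j hj
        split_ifs at this
        exact Option.some.inj this) (fun _ _ => rfl) hr
  exact ⟨e, r e, hrx e, hre ▸ hT⟩

theorem Certifies.complete {T : ℕ → ℕ → Prop} {p : ℕ → ℕ} {f : C(unitInterval, ℝ)}
    (hp : contRep.Name p f) {c : ℕ} {x : unitInterval} (hx : (x : ℝ) = ratOf c)
    (h : ∀ r, IsCauchyName r (f x) → ∃ e, T e (r e)) :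
    ∃ K₀, ∀ K ≥ K₀, Certifies T ((List.range K).map p) c := by
  obtain ⟨r, hr, hrx⟩ := hp (fun _ => c) x
    (show IsCauchyName _ (x : ℝ) from hx ▸ isCauchyName_const c)
  obtain ⟨e, he⟩ := h r hrx
  obtain ⟨k, hk, hk0⟩ := hr e
  -- Long enough to contain `e` and every entry of `p` consulted up to the answer.
  refine ⟨e + 1 + (Finset.range (k + 1)).sup (fun j => prefixCode e (fun _ => c) j) + 1,
    fun K hK => ?_⟩
  have hlt : ∀ j ≤ k, prefixCode e (fun _ => c) j < K := fun j hj => by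
    have : prefixCode e (fun _ => c) j ≤
        (Finset.range (k + 1)).sup (fun j => prefixCode e (fun _ => c) j) :=
      Finset.le_sup (f := fun j => prefixCode e (fun _ => c) j)
        (Finset.mem_range.2 (Nat.lt_succ_of_le hj))
    omega
  have hkK : k < K := (le_prefixCode_right e (fun _ => c) k).trans_lt (hlt k le_rfl)
  refine ⟨e, by simp only [List.length_map, List.length_range]; omega, k,
    by simpa using hkK, ?_, fun j hj => ?_⟩
  · rw [getElem?_map_range, if_pos (hlt k le_rfl), Option.getD_some, hk]
    exact ⟨Nat.succ_pos _, he⟩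
  · rw [getElem?_map_range, if_pos (hlt j hj.le), hk0 j hj]

theorem exists_negTest {y : ℝ} (hy : y < 0) (r : ℕ → ℕ) (hr : IsCauchyName r y) :
    ∃ e, NegTest e (r e) := by
  -- The approximation error and the margin of the test each cost `2 ^ (-e)`.
  obtain ⟨e, he⟩ := exists_pow_lt_of_lt_one (show (0 : ℝ) < -y / 2 by linarith)
    (show (1 / 2 : ℝ) < 1 by norm_num)
  have := abs_le.1 (hr e)
  exact ⟨e, (negTest_iff _ _).2 (by linarith [this.1])⟩

theorem exists_posTest {y : ℝ} (hy : 0 < y) (r : ℕ → ℕ) (hr : IsCauchyName r y) :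
    ∃ e, PosTest e (r e) := by
  obtain ⟨e, he⟩ := exists_pow_lt_of_lt_one (show (0 : ℝ) < y / 2 by linarith)
    (show (1 / 2 : ℝ) < 1 by norm_num)
  have := abs_le.1 (hr e)
  exact ⟨e, (posTest_iff _ _).2 (by linarith [this.2])⟩

theorem Certifies.neg {p : ℕ → ℕ} {f : C(unitInterval, ℝ)} (hp : contRep.Name p f) {K c : ℕ}
    {x : unitInterval} (hx : (x : ℝ) = ratOf c)
    (h : Certifies NegTest ((List.range K).map p) c) : f x < 0 := by
  obtain ⟨e, v, h1, h2⟩ := h.sound hp hx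
  linarith [(abs_le.1 h1).2, (negTest_iff _ _).1 h2]

theorem Certifies.pos {p : ℕ → ℕ} {f : C(unitInterval, ℝ)} (hp : contRep.Name p f) {K c : ℕ}
    {x : unitInterval} (hx : (x : ℝ) = ratOf c)
    (h : Certifies PosTest ((List.range K).map p) c) : 0 < f x := by
  obtain ⟨e, v, h1, h2⟩ := h.sound hp hx
  linarith [(abs_le.1 h1).1, (posTest_iff _ _).1 h2]

/-! ### Bisection of a real function, and its finite versions -/

open Classical in
/-- The numerators of the left end points of the bisection intervals of `g`. -/
noncomputable def bisectLeft (g : ℝ → ℝ) : ℕ → ℕ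
  | 0 => 0
  | n + 1 => if g (((2 * bisectLeft g n + 1 : ℕ) : ℝ) / 2 ^ (n + 1)) < 0 then
      2 * bisectLeft g n + 1 else 2 * bisectLeft g n

theorem bisectLeft_succ_le (g : ℝ → ℝ) (n : ℕ) : bisectLeft g n + 1 ≤ 2 ^ n := by
  induction n with
  | zero => simp [bisectLeft]
  | succ n ih =>
    rw [bisectLeft, pow_succ]
    split_ifs <;> omega

theorem bisectLeft_signs {g : ℝ → ℝ} (h0 : g 0 ≤ 0) (h1 : 0 ≤ g 1) (n : ℕ) :
    g ((bisectLeft g n : ℝ) / 2 ^ n) ≤ 0 ∧ 0 ≤ g ((bisectLeft g n : ℝ) / 2 ^ n + 1 / 2 ^ n) := by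
  induction n with
  | zero => simpa [bisectLeft] using ⟨h0, h1⟩
  | succ n ih =>
    have hpow : (2 : ℝ) ^ (n + 1) = 2 * 2 ^ n := by ring
    have h2 : (0 : ℝ) < 2 ^ n := by positivity
    rw [bisectLeft]
    split_ifs with h
    · refine ⟨h.le, ?_⟩
      convert ih.2 using 2
      rw [hpow]
      push_cast
      field_simp
      ring
    · constructor
      · convert ih.1 using 2
        rw [hpow]
        push_cast
        field_simp
      · refine (not_lt.1 h).trans_eq (congrArg g ?_)
        push_cast
        ring

/-- Left and right end points converge to the same `x`; their opposite weak signs pass to the limit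
and force a zero. -/
theorem exists_zero_bisectLeft {g : ℝ → ℝ} (hg : Continuous g) (h0 : g 0 ≤ 0) (h1 : 0 ≤ g 1) :
    ∃ x ∈ Set.Icc (0 : ℝ) 1, g x = 0 ∧
      ∀ n, |x - (bisectLeft g n : ℝ) / 2 ^ n| ≤ (1 / 2 : ℝ) ^ n := by
  set a : ℕ → ℝ := fun n => (bisectLeft g n : ℝ) / 2 ^ n with ha
  have hstep : ∀ n, dist (a n) (a (n + 1)) ≤ 1 / 2 / 2 ^ n := by
    intro n
    have hpow : (2 : ℝ) ^ (n + 1) = 2 * 2 ^ n := by ring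
    have h2 : (0 : ℝ) < 2 ^ n := by positivity
    have : a (n + 1) = a n ∨ a (n + 1) = a n + 1 / 2 / 2 ^ n := by
      simp only [ha]
      rw [bisectLeft]
      split_ifs
      · right
        rw [hpow]
        push_cast
        field_simp
      · left
        rw [hpow]
        push_cast
        field_simp
    rcases this with h | h
    · rw [h, dist_self]
      positivity
    · rw [h, dist_self_add_right, Real.norm_of_nonneg (by positivity)]
  obtain ⟨x, hx⟩ := cauchySeq_tendsto_of_complete (cauchySeq_of_le_geometric_two hstep)
  have hpow : Filter.Tendsto (fun n : ℕ => (1 : ℝ) / 2 ^ n) Filter.atTop (𝓝 0) := by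
    simpa using tendsto_pow_atTop_nhds_zero_of_lt_one (r := (1 / 2 : ℝ)) (by norm_num) (by norm_num)
  have hx' : Filter.Tendsto (fun n => a n + 1 / 2 ^ n) Filter.atTop (𝓝 x) := by
    simpa using hx.add hpow
  refine ⟨x, ⟨ge_of_tendsto' hx fun n => by positivity, le_of_tendsto' hx fun n => ?_⟩,
    le_antisymm ?_ ?_, fun n => ?_⟩
  · refine div_le_one_of_le₀ ?_ (by positivity)
    exact_mod_cast (Nat.le_succ _).trans (bisectLeft_succ_le g n)
  · exact le_of_tendsto' ((hg.tendsto x).comp hx) fun n => (bisectLeft_signs h0 h1 n).1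
  · exact ge_of_tendsto' ((hg.tendsto x).comp hx') fun n => (bisectLeft_signs h0 h1 n).2
  · rw [← Real.dist_eq, dist_comm, one_div, inv_pow, ← one_div]
    exact dist_le_of_le_geometric_two_of_tendsto hstep hx n

/-- The extension of a function on the unit interval to the real line by constants. -/
noncomputable def extendIcc (f : C(unitInterval, ℝ)) : ℝ → ℝ :=
  Set.IccExtend zero_le_one f

theorem midpoint_mem (g : ℝ → ℝ) (n : ℕ) :
    ((2 * bisectLeft g n + 1 : ℕ) : ℝ) / 2 ^ (n + 1) ∈ Set.Icc (0 : ℝ) 1 := by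
  refine ⟨by positivity, div_le_one_of_le₀ ?_ (by positivity)⟩
  have := bisectLeft_succ_le g n
  have : 2 * bisectLeft g n + 1 ≤ 2 ^ (n + 1) := by rw [pow_succ]; omega
  exact_mod_cast this

/-- Certificates are never wrong, so a finite bisection may stall but cannot take a different
branch. -/
theorem bisect_sound {p : ℕ → ℕ} {f : C(unitInterval, ℝ)} (hp : contRep.Name p f) {K : ℕ} :
    ∀ {n m : ℕ}, bisect ((List.range K).map p) n = some m → m = bisectLeft (extendIcc f) n
  | 0, m, h => (Option.some.inj h).symm
  | n + 1, m, h => by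
    obtain ⟨m', hm', hm⟩ := Option.bind_eq_some_iff.1 h
    obtain rfl := bisect_sound hp hm'
    have hx := (ratOf_dyadicCode (2 * bisectLeft (extendIcc f) n + 1) (n + 1)).symm
    have hf : extendIcc f _ = _ := Set.IccExtend_of_mem zero_le_one f (midpoint_mem (extendIcc f) n)
    rw [bisectStep] at hm
    split_ifs at hm with h1 h2
    · have := h1.neg hp (x := ⟨_, midpoint_mem (extendIcc f) n⟩) hx
      rw [bisectLeft, if_pos (hf ▸ this), ← Option.some.inj hm]
    · have := h2.pos hp (x := ⟨_, midpoint_mem (extendIcc f) n⟩) hx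
      rw [bisectLeft, if_neg (not_lt.2 (hf ▸ this.le)), ← Option.some.inj hm]

/-- Without rational zeros each midpoint has a strict sign, which all long enough finite parts
certify. -/
theorem bisect_complete {p : ℕ → ℕ} {f : C(unitInterval, ℝ)} (hp : contRep.Name p f)
    (hf0 : ∀ (c : ℕ) (x : unitInterval), (x : ℝ) = ratOf c → f x ≠ 0) (n : ℕ) :
    ∃ K₀, ∀ K ≥ K₀, bisect ((List.range K).map p) n = some (bisectLeft (extendIcc f) n) := by
  induction n with
  | zero => exact ⟨0, fun _ _ => rfl⟩
  | succ n ih =>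
    obtain ⟨K₁, hK₁⟩ := ih
    have hx := (ratOf_dyadicCode (2 * bisectLeft (extendIcc f) n + 1) (n + 1)).symm
    have hf : extendIcc f _ = _ := Set.IccExtend_of_mem zero_le_one f (midpoint_mem (extendIcc f) n)
    rcases (hf0 _ ⟨_, midpoint_mem (extendIcc f) n⟩ hx).lt_or_gt with hlt | hgt
    · obtain ⟨K₂, hK₂⟩ := Certifies.complete hp hx (exists_negTest hlt)
      refine ⟨max K₁ K₂, fun K hK => ?_⟩
      rw [bisect, hK₁ K (le_of_max_le_left hK), Option.bind_some, bisectStep,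
        if_pos (hK₂ K (le_of_max_le_right hK)), bisectLeft, if_pos (hf ▸ hlt)]
    · obtain ⟨K₂, hK₂⟩ := Certifies.complete hp hx (exists_posTest hgt)
      refine ⟨max K₁ K₂, fun K hK => ?_⟩
      rw [bisect, hK₁ K (le_of_max_le_left hK), Option.bind_some, bisectStep,
        if_neg (fun h => (h.neg hp hx).not_gt hgt), if_pos (hK₂ K (le_of_max_le_right hK)),
        bisectLeft, if_neg (not_lt.2 (hf ▸ hgt.le))]

theorem zeroProgram_rational (c : ℕ) (q : ℕ → ℕ) :
    KApp zeroProgram (consSeq (c + 1) q) fun _ => c := fun n =>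
  ⟨1, by rw [zeroProgram_succ, if_neg (Nat.succ_ne_zero c)], fun j hj => by
    rw [Nat.lt_one_iff.1 hj, zeroProgram_zero]⟩

/-- Completeness gives an answer for each `n`; soundness makes the answer independent of the prefix
on which it first appears. -/
theorem zeroProgram_bisect {p : ℕ → ℕ} {f : C(unitInterval, ℝ)} (hp : contRep.Name p f)
    (hf0 : ∀ (c : ℕ) (x : unitInterval), (x : ℝ) = ratOf c → f x ≠ 0) :
    KApp zeroProgram (consSeq 0 p) fun n => dyadicCode (bisectLeft (extendIcc f) n) n := by
  obtain ⟨r, hr, hr'⟩ := exists_kApp (p := zeroProgram) (q := consSeq 0 p) fun n => by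
    obtain ⟨K, hK⟩ := bisect_complete hp hf0 n
    refine ⟨K + 1, ?_⟩
    rw [zeroProgram_succ, if_pos rfl, hK K le_rfl]
    exact Nat.succ_ne_zero _
  convert hr using 1
  funext n
  obtain ⟨k, hk⟩ := hr' n
  cases k with
  | zero => simp [zeroProgram_zero] at hk
  | succ k =>
    rw [zeroProgram_succ, if_pos rfl] at hk
    cases hb : bisect ((List.range k).map p) n with
    | none => simp [hb] at hk
    | some m =>
      simp only [hb, Option.map_some, Option.getD_some, Nat.add_right_cancel_iff] at hk
      rw [← bisect_sound hp hb, hk]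

/-! ### The complexity of zero-finding -/

open Classical in
/-- The advice for zero-finding on `f`: the first code of a rational zero plus one, or `0` if there
is no rational zero. -/
noncomputable def zeroAdvice (f : C(unitInterval, ℝ)) : ℕ :=
  if h : ∃ c, ∃ x : unitInterval, (x : ℝ) = ratOf c ∧ f x = 0 then Nat.find h + 1 else 0

theorem zeroProgram_correct {f : C(unitInterval, ℝ)} (hf : f ∈ mdom Intermed) {p : ℕ → ℕ}
    (hp : contRep.Name p f) :
    ∃ r, KApp zeroProgram (consSeq (zeroAdvice f) p) r ∧ ∃ x ∈ Intermed f, unitRep.Name r x := by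
  classical
  obtain ⟨-, hdom, -⟩ := hf
  by_cases h : ∃ c, ∃ x : unitInterval, (x : ℝ) = ratOf c ∧ f x = 0
  · rw [zeroAdvice, dif_pos h]
    obtain ⟨x, hx, hfx⟩ := Nat.find_spec h
    exact ⟨_, zeroProgram_rational _ p, x, ⟨hdom, hfx⟩,
      show IsCauchyName _ (x : ℝ) from hx ▸ isCauchyName_const _⟩
  · rw [zeroAdvice, dif_neg h]
    push Not at h
    have hc : Continuous (extendIcc f) := f.continuous.Icc_extend'
    have h0 : extendIcc f 0 = f 0 := Set.IccExtend_left zero_le_one f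
    have h1 : extendIcc f 1 = f 1 := Set.IccExtend_right zero_le_one f
    obtain ⟨x, hx, hfx, hax⟩ := exists_zero_bisectLeft hc
      (by rw [h0, hdom.2.1]; norm_num) (by rw [h1, hdom.2.2]; norm_num)
    refine ⟨_, zeroProgram_bisect hp h, ⟨x, hx⟩, ⟨hdom, ?_⟩, ?_⟩
    · rw [← hfx]
      exact (Set.IccExtend_of_mem zero_le_one f hx).symm
    · show IsCauchyName _ x
      intro n
      rw [ratOf_dyadicCode]
      exact hax n

theorem exists_kComputable_intermed :
    ∃ k ≤ ℵ₀, KComputable contRep unitRep Intermed k := by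
  let D : ℕ → Set C(unitInterval, ℝ) := fun i => {f ∈ mdom Intermed | zeroAdvice f = i}
  -- Unused advice values give empty classes, which a partition excludes; the notation is undefined
  -- there.
  let Δ : Set (Set C(unitInterval, ℝ)) := {E | ∃ i, (D i).Nonempty ∧ D i = E}
  have hcount : Δ.Countable := (Set.countable_range D).mono (by
    rintro _ ⟨i, -, rfl⟩
    exact ⟨i, rfl⟩)
  refine ⟨#Δ, hcount.le_aleph0, Δ, ⟨?_, ?_, ?_⟩, hcount, rfl,
    fun i => ⟨(D i).Nonempty, fun _ => D i⟩, ?_, zeroProgram, primrec_zeroProgram.to_comp, ?_⟩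
  · ext f
    constructor
    · rintro ⟨_, ⟨i, -, rfl⟩, hf⟩
      exact hf.1
    · exact fun hf => ⟨D (zeroAdvice f), ⟨_, ⟨f, hf, rfl⟩, rfl⟩, hf, rfl⟩
  · rintro _ ⟨i, -, rfl⟩ _ ⟨j, -, rfl⟩ hij
    refine Set.disjoint_left.2 fun f hi hj => hij ?_
    rw [← hi.2, ← hj.2]
  · rintro ⟨i, hi, hi'⟩
    exact hi.ne_empty hi'
  · ext E
    exact ⟨fun ⟨i, h, hE⟩ => ⟨i, h, hE⟩, fun ⟨i, h, hE⟩ => ⟨i, h, hE⟩⟩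
  · rintro i _ f q ⟨-, rfl⟩ ⟨hf, rfl⟩ hq
    exact zeroProgram_correct hf hq

theorem sInf_eq_aleph0 {P : Cardinal → Prop} (hle : ∃ k ≤ ℵ₀, P k) (hnot : ∀ d : ℕ, ¬ P d) :
    sInf {k | P k} = ℵ₀ := by
  obtain ⟨k, hk, hPk⟩ := hle
  refine le_antisymm ((csInf_le' hPk).trans hk) (le_csInf ⟨k, hPk⟩ fun l hl => ?_)
  by_contra hlt
  obtain ⟨d, rfl⟩ := Cardinal.lt_aleph0.1 (not_le.1 hlt)
  exact hnot d hl

end Advice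

theorem theorem3p12 :
    (Advice.computabilityCardinal Advice.contRep Advice.unitRep Advice.Intermed = Cardinal.aleph0 ∧
      Advice.discontinuityCardinal Advice.Intermed = Cardinal.aleph0) ∧
    ∀ d : ℕ, ¬ Advice.KwiseContinuous Advice.psiGreater Advice.realRep Advice.Select
      (d : Cardinal) := by
  obtain ⟨k, hk, hcomp⟩ := Advice.exists_kComputable_intermed
  exact ⟨⟨Advice.sInf_eq_aleph0 ⟨k, hk, hcomp⟩
      fun d hd => Advice.not_kContinuous_intermed d hd.kContinuous,
    -- The passage from computability to continuity serves both ways: it transfers the upper bound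
    -- here and the lower bound for `computabilityCardinal`.
    Advice.sInf_eq_aleph0 ⟨k, hk, hcomp.kContinuous⟩ Advice.not_kContinuous_intermed⟩,
    Advice.not_kwiseContinuous_select⟩
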